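/- Let $k$ be a field, $G$ a discrete group with classifying space $BG=N(\star/\!/G)$ and universal bundle $EG\to BG$, and $X$ a simplicial set. By an $E_\infty$-algebra we mean a (unital) algebra over the Barratt–Eccles operad in unbounded differential graded $k$-vector spaces; these form a category $E_\infty\text{-}\mathsf{Alg}$, with quasi-isomorphisms as weak equivalences, degreewise surjections as fibrations, and with the tensoring $Y\otimes A$ over simplicial sets $Y$ that is left adjoint to the function object $B\mapsto B^{Y}=\operatorname{Hom}(N_*(Y),B)$. Let $A$ be a $G$-equivariant $E_\infty$-algebra, i.e. a functor $\star/\!/G\to E_\infty\text{-}\mathsf{Alg}$, and let $QA\to A$ be a $G$-equivariant map which is a cofibrant replacement of the underlying $E_\infty$-algebra. For a principal $G$-bundle $P$ over $X$ let $$\int_P A:=P\overset{\mathbb L}{\otimes}_G A=\int^{n}\bigl(P\times\Delta_n\times G^n\bigr)\otimes QA ,$$ the coend in $E_\infty\text{-}\mathsf{Alg}$ given by the realization of the simplicial bar construction $B_*(P,\star/\!/G,QA)$, and for a map $\varphi:X\to BG$ let $\int_\varphi A:=\int_{\varphi^*EG}A$ be the equivariant higher Hochschild chains of $\varphi$ with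 coefficients in $A$. Let $\mathsf{PBun}_G(X)$ be the groupoid of principal $G$-bundles over $X$ and $G$-equivariant maps over $X$. Then: 1. The $E_\infty$-algebra $\int_P A$ exists for every principal $G$-bundle $P$ over $X$. 2. For every choice of the coends $\int_P A$, there is a unique functor $$\int_{?}A:\mathsf{PBun}_G(X)\longrightarrow E_\infty\text{-}\mathsf{Alg}$$ that sends $P$ to $\int_P A$ and $f:P\to P'$ to the map induced by the maps $f\times\mathrm{id}\times\mathrm{id}:P\times\Delta_n\times G^n\to P'\times\Delta_n\times G^n$. 3. For all $\varphi_0,\varphi_1:X\to BG$, every isomorphism $\varphi_0^*EG\cong\varphi_1^*EG$ of principal $G$-bundles induces an isomorphism $\int_{\varphi_0}A\cong\int_{\varphi_1}A$ of $E_\infty$-algebras. 4. For every $\varphi:X\to BG$, the induced maps define an action of the group $\operatorname{Aut}(\varphi^*EG)$ of bundle automorphisms on $\int_\varphi A$ by automorphisms of $E_\infty$-algebras. -/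

import Mathlib

open CategoryTheory MonoidalCategory Opposite

universe u

namespace EqHH

/-! ## Signs and differential graded vector spaces -/

/-- The sign `(-1)^n`. -/
abbrev sgn (n : ℤ) : ℤˣ := n.negOnePow

section DG

variable {k : Type u} [Field k]

/-- The total space `⨁ i, Xᵢ` of a (homologically graded, unbounded) complex of vector spaces. -/
abbrev Tot (X : ChainComplex (ModuleCat.{u} k) ℤ) : Type u := DirectSum ℤ (fun i => X.X i)

/-- The elements of the total space that are homogeneous of degree `i`. -/
def homog (X : ChainComplex (ModuleCat.{u} k) ℤ) (i : ℤ) : Submodule k (Tot X) :=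
  LinearMap.range (DirectSum.lof k ℤ (fun i => X.X i) i)

/-- The differential, of degree `-1`, on the total space. -/
noncomputable def totD (X : ChainComplex (ModuleCat.{u} k) ℤ) : Tot X →ₗ[k] Tot X :=
  DirectSum.toModule k ℤ _
    (fun i => DirectSum.lof k ℤ (fun i => X.X i) (i - 1) ∘ₗ (X.d i (i - 1)).hom)

/-- The map induced by a chain map on total spaces. -/
noncomputable def totMap {X Y : ChainComplex (ModuleCat.{u} k) ℤ} (f : X ⟶ Y) :
    Tot X →ₗ[k] Tot Y :=
  DirectSum.lmap (fun i => (f.f i).hom)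

lemma totMap_id (X : ChainComplex (ModuleCat.{u} k) ℤ) : totMap (𝟙 X) = LinearMap.id :=
  DirectSum.lmap_id

lemma totMap_comp {X Y Z : ChainComplex (ModuleCat.{u} k) ℤ} (f : X ⟶ Y) (g : Y ⟶ Z) :
    totMap (f ≫ g) = totMap g ∘ₗ totMap f :=
  DirectSum.lmap_comp _ _

end DG

/-! ## The Barratt-Eccles operad

The Barratt-Eccles operad `E` is the `E_∞`-operad given in arity `r ≥ 0` by the normalized chains
`E(r) = N_*(EΣ_r; k)` on the simplicial set with `d`-simplices `Σ_r^{d+1}`.  A permutation is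
written as the word in which every letter of `Fin r` occurs exactly once, so that the generators
of `E(r)` in degree `d` are the families `w : Fin (d + 1) → Arr r`, and those with
`w_j = w_{j+1}` for some `j` are zero. -/

/-- A permutation of `Fin r`, written as a word. -/
def Arr (r : ℕ) : Type := {l : List (Fin r) // l.Nodup ∧ ∀ x, x ∈ l}

/-- The left action of the symmetric group by renaming the letters. -/
def Arr.relabel {r : ℕ} (σ : Equiv.Perm (Fin r)) (l : Arr r) : Arr r :=
  ⟨l.1.map σ, l.2.1.map σ.injective, fun x => by
    rw [List.mem_map]; exact ⟨σ.symm x, l.2.2 _, by simp⟩⟩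

/-- The word with one letter, which is the unit of the operad. -/
def Arr.one : Arr 1 := ⟨[0], by simp, fun x => by simp [Subsingleton.elim x 0]⟩

/-- The position, among `r + s` letters, of the letter `t ≠ i` after `s` letters have been put in
the place of `i`. -/
def outerIdx {r : ℕ} (i : Fin (r + 1)) (s : ℕ) (t : Fin (r + 1)) (h : t ≠ i) : Fin (r + s) :=
  if h' : t < i then ⟨t, by have := i.2; have : t.1 < i.1 := h'; omega⟩
  else ⟨t.1 - 1 + s, by
    have h1 := t.2
    have h2 : ¬ t.1 < i.1 := h'
    have h3 : t.1 ≠ i.1 := fun e => h (Fin.ext e)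
    omega⟩

/-- The position, among `r + s` letters, of the `u`-th of the letters put in the place of `i`. -/
def innerIdx {r : ℕ} (i : Fin (r + 1)) {s : ℕ} (u : Fin s) : Fin (r + s) :=
  ⟨i.1 + u.1, by have := i.2; have := u.2; omega⟩

lemma outerIdx_val {r : ℕ} (i : Fin (r + 1)) (s : ℕ) (t : Fin (r + 1)) (h : t ≠ i) :
    (outerIdx i s t h).1 = if t.1 < i.1 then t.1 else t.1 - 1 + s := by
  unfold outerIdx
  by_cases h' : t < i
  · rw [dif_pos h', if_pos (show t.1 < i.1 from h')]
  · rw [dif_neg h', if_neg (show ¬ t.1 < i.1 from h')]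

/-- The partial composition `l ∘_i m` of permutations: the word `m` is substituted for the letter
`i` of the word `l`. -/
def Arr.comp {r s : ℕ} (i : Fin (r + 1)) (l : Arr (r + 1)) (m : Arr s) : Arr (r + s) :=
  ⟨l.1.flatMap (fun t => if h : t = i then m.1.map (innerIdx i) else [outerIdx i s t h]), by
    rw [List.nodup_flatMap]
    constructor
    · intro t _
      split
      · refine m.2.1.map (fun a b hab => ?_)
        have := congrArg Fin.val hab
        simp only [innerIdx] at this
        exact Fin.ext (by omega)
      · simp
    · refine l.2.1.imp (fun {a b} hab => ?_)
      intro x hx hy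
      by_cases ha : a = i <;> by_cases hb : b = i
      · exact hab (ha.trans hb.symm)
      · simp only [ha, hb, dif_pos, dif_neg, not_false_eq_true, List.mem_map,
          List.mem_singleton] at hx hy
        obtain ⟨v, _, rfl⟩ := hx
        have h1 := congrArg Fin.val hy
        rw [outerIdx_val] at h1
        simp only [innerIdx] at h1
        have := v.2
        have h3 : b.1 ≠ i.1 := fun e => hb (Fin.ext e)
        split_ifs at h1 <;> omega
      · simp only [ha, hb, dif_pos, dif_neg, not_false_eq_true, List.mem_map,
          List.mem_singleton] at hx hy
        obtain ⟨v, _, rfl⟩ := hy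
        have h1 := congrArg Fin.val hx
        rw [outerIdx_val] at h1
        simp only [innerIdx] at h1
        have := v.2
        have h3 : a.1 ≠ i.1 := fun e => ha (Fin.ext e)
        split_ifs at h1 <;> omega
      · simp only [ha, hb, dif_neg, not_false_eq_true, List.mem_singleton] at hx hy
        have h1 := congrArg Fin.val (hx.symm.trans hy)
        rw [outerIdx_val, outerIdx_val] at h1
        have h2 : a.1 ≠ i.1 := fun e => ha (Fin.ext e)
        have h3 : b.1 ≠ i.1 := fun e => hb (Fin.ext e)
        have h4 : a.1 ≠ b.1 := fun e => hab (Fin.ext e)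
        split_ifs at h1 <;> omega, by
    intro x
    rw [List.mem_flatMap]
    by_cases h1 : x.1 < i.1
    · have hne : (⟨x.1, by omega⟩ : Fin (r + 1)) ≠ i := fun e => by
        have := congrArg Fin.val e; simp only at this; omega
      refine ⟨⟨x.1, by omega⟩, l.2.2 _, ?_⟩
      rw [dif_neg hne, List.mem_singleton]
      refine Fin.ext ?_
      rw [outerIdx_val, if_pos h1]
    · by_cases h2 : x.1 < i.1 + s
      · refine ⟨i, l.2.2 _, ?_⟩
        rw [dif_pos rfl, List.mem_map]
        refine ⟨⟨x.1 - i.1, by omega⟩, m.2.2 _, Fin.ext ?_⟩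
        simp only [innerIdx]; omega
      · have hx := x.2
        have hne : (⟨x.1 - s + 1, by omega⟩ : Fin (r + 1)) ≠ i := fun e => by
          have := congrArg Fin.val e; simp only at this; omega
        refine ⟨⟨x.1 - s + 1, by omega⟩, l.2.2 _, ?_⟩
        rw [dif_neg hne, List.mem_singleton]
        refine Fin.ext ?_
        rw [outerIdx_val, if_neg (by simp only; omega)]
        simp only; omega⟩

open Classical in
/-- The lattice paths from `(0, 0)` to `(p, q)`, i.e. the nondegenerate `(p + q)`-simplices of
`Δ^p × Δ^q`, which index the terms of the Eilenberg-Zilber shuffle map. -/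
noncomputable def paths (p q : ℕ) : Finset (Fin (p + q + 1) → Fin (p + 1) × Fin (q + 1)) :=
  Finset.univ.filter StrictMono

/-- The exponent of the sign of the shuffle belonging to a lattice path: the number of pairs
consisting of a step in the first direction and an earlier step in the second direction. -/
def pathExp {p q : ℕ} (γ : Fin (p + q + 1) → Fin (p + 1) × Fin (q + 1)) : ℤ :=
  ∑ j : Fin (p + q), (((γ j.succ).1.1 : ℤ) - (γ j.castSucc).1.1) * (γ j.castSucc).2.1

/-! ## `E_∞`-algebras -/

/-- An `E_∞`-algebra in differential graded `k`-vector spaces: an algebra over the Barratt-Eccles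
operad.  The operation belonging to a generator `w` is `act w`, and the operation belonging to a
linear combination of generators is the corresponding linear combination. -/
structure EInftyAlg (k : Type u) [Field k] where
  /-- the underlying differential graded vector space -/
  X : ChainComplex (ModuleCat.{u} k) ℤ
  /-- the operation belonging to a generator of degree `d` in arity `r` -/
  act : ∀ {r d : ℕ}, (Fin (d + 1) → Arr r) → MultilinearMap k (fun _ : Fin r => Tot X) (Tot X)
  /-- the operation has degree `d` -/
  act_mem : ∀ {r d : ℕ} (w : Fin (d + 1) → Arr r) (e : Fin r → ℤ) (x : Fin r → Tot X),
    (∀ t, x t ∈ homog X (e t)) → act w x ∈ homog X (d + ∑ t, e t)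
  /-- degenerate simplices are zero in the normalized chains -/
  act_degenerate : ∀ {r d : ℕ} (w : Fin (d + 1) → Arr r) (j : Fin d),
    w j.castSucc = w j.succ → act w = 0
  /-- compatibility with the differentials, in degree zero -/
  act_d_zero : ∀ {r : ℕ} (w : Fin (0 + 1) → Arr r) (e : Fin r → ℤ) (x : Fin r → Tot X),
    (∀ t, x t ∈ homog X (e t)) →
    totD X (act w x) =
      ∑ t, sgn (∑ s with s < t, e s) • act w (Function.update x t (totD X (x t)))
  /-- compatibility with the differentials, in positive degrees -/
  act_d_succ : ∀ {r d : ℕ} (w : Fin (d + 1 + 1) → Arr r) (e : Fin r → ℤ) (x : Fin r → Tot X),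
    (∀ t, x t ∈ homog X (e t)) →
    totD X (act w x) =
      (∑ l : Fin (d + 1 + 1), sgn l.1 • act (fun j => w (l.succAbove j)) x) +
      sgn ((d + 1 : ℕ) : ℤ) •
        ∑ t, sgn (∑ s with s < t, e s) • act w (Function.update x t (totD X (x t)))
  /-- equivariance, with the Koszul sign of the permutation of the arguments -/
  act_relabel : ∀ {r d : ℕ} (w : Fin (d + 1) → Arr r) (σ : Equiv.Perm (Fin r)) (e : Fin r → ℤ)
    (x : Fin r → Tot X), (∀ t, x t ∈ homog X (e t)) →
    act (fun j => (w j).relabel σ) x =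
      sgn (∑ a, ∑ b with a < b ∧ σ b < σ a, e (σ a) * e (σ b)) • act w (fun t => x (σ t))
  /-- the unit of the operad acts as the identity -/
  act_one : ∀ x : Fin 1 → Tot X, act (fun _ : Fin (0 + 1) => Arr.one) x = x 0
  /-- the composition `w ∘_i v` of the operad, defined by the shuffle map and the composition of
  permutations, acts as the composition of the operations -/
  act_comp : ∀ {r s p q : ℕ} (i : Fin (r + 1)) (w : Fin (p + 1) → Arr (r + 1))
    (v : Fin (q + 1) → Arr s) (e : Fin (r + s) → ℤ) (x : Fin (r + s) → Tot X),
    (∀ t, x t ∈ homog X (e t)) →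
    (∑ γ ∈ paths p q, sgn (pathExp γ) •
        act (d := p + q) (fun j => Arr.comp i (w (γ j).1) (v (γ j).2)) x) =
      sgn (q * ∑ t with t.1 < i.1, e t) •
        act w (fun t => if h : t = i then act v (fun a => x (innerIdx i a))
          else x (outerIdx i s t h))

namespace EInftyAlg

variable {k : Type u} [Field k]

/-- A morphism of `E_∞`-algebras: a chain map that commutes with all operations. -/
@[ext]
structure Hom (A B : EInftyAlg k) where
  hom : A.X ⟶ B.X
  map_act : ∀ {r d : ℕ} (w : Fin (d + 1) → Arr r) (x : Fin r → Tot A.X),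
    totMap hom (A.act w x) = B.act w (fun t => totMap hom (x t))

instance : Category (EInftyAlg k) where
  Hom := Hom
  id A := ⟨𝟙 _, fun w x => by simp [totMap_id]⟩
  comp f g := ⟨f.hom ≫ g.hom, fun w x => by
    simp only [totMap_comp, LinearMap.comp_apply, f.map_act, g.map_act]⟩

/-- The weak equivalences of `E_∞`-algebras are the quasi-isomorphisms. -/
def IsWeakEquiv {A B : EInftyAlg k} (f : A ⟶ B) : Prop := QuasiIso (Hom.hom f)

/-- The fibrations of `E_∞`-algebras, for the model structure induced from the projective model
structure on complexes, are the degreewise surjections. -/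
def IsFib {A B : EInftyAlg k} (f : A ⟶ B) : Prop :=
  ∀ i, Function.Surjective ((Hom.hom f).f i)

/-- An `E_∞`-algebra is cofibrant if the map from the initial algebra to it has the left lifting
property with respect to all trivial fibrations. -/
def IsCof (C : EInftyAlg k) : Prop :=
  ∀ ⦃A B : EInftyAlg k⦄ (p : A ⟶ B), IsFib p → IsWeakEquiv p →
    ∀ f : C ⟶ B, ∃ g : C ⟶ A, g ≫ p = f

end EInftyAlg

/-- A `G`-equivariant `E_∞`-algebra: a functor from the groupoid `⋆//G` with one object and
automorphism group `G` to `E_∞`-algebras. -/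
abbrev EquivEInftyAlg (G : Type u) [Group G] (k : Type u) [Field k] := SingleObj G ⥤ EInftyAlg k

/-- The `E_∞`-algebra underlying a `G`-equivariant one. -/
abbrev EquivEInftyAlg.under {G : Type u} [Group G] {k : Type u} [Field k]
    (A : EquivEInftyAlg G k) : EInftyAlg k := A.obj (SingleObj.star G)

/-- `q : Q ⟶ A` exhibits `Q`, with its `G`-action, as a cofibrant replacement of `A` as an
`E_∞`-algebra: the algebra underlying `Q` is cofibrant and `q` is a weak equivalence. -/
structure IsCofReplacement {G : Type u} [Group G] {k : Type u} [Field k]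
    {Q A : EquivEInftyAlg G k} (q : Q ⟶ A) : Prop where
  cof : Q.under.IsCof
  weq : EInftyAlg.IsWeakEquiv (q.app (SingleObj.star G))

/-! ## The action of the Barratt-Eccles operad on chains of simplicial sets

The Barratt-Eccles operad acts on normalized chains by natural maps
`E(r) ⊗ N_*(Y) → N_*(Y)^{⊗ r}`: the table reduction turns a simplex of permutations into a sum of
surjections, and a surjection acts by cutting a simplex into intervals. -/

/-- The table reduction, with the letters of `del` deleted from all rows. -/
def tableReductionAux {r : ℕ} (del : List (Fin r)) : List (List (Fin r)) → List (List (Fin r))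
  | [] => []
  | l :: ls =>
    let m := l.filter (fun a => a ∉ del)
    if ls = [] then [m]
    else (List.range m.length).flatMap (fun c =>
      (tableReductionAux (del ++ m.take c) ls).map (fun u => m.take (c + 1) ++ u))

/-- The table reduction, from simplices of permutations to sums of surjections, both written as
words.  From the first row an initial segment is read off, in all possible ways with at least one
letter; then its letters, except for the last one (the caesura), are deleted from all the
following rows, and one goes on with the next row.  From the last row everything is read off. -/
def tableReduction {r : ℕ} (ls : List (List (Fin r))) : List (List (Fin r)) :=
  tableReductionAux [] ls

open Classical in
/-- The ways to cut `{0 < … < n}` into `N` intervals `[c_j, c_{j+1}]` that overlap in their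
endpoints. -/
noncomputable def cuts (N n : ℕ) : Finset (Fin (N + 1) → Fin (n + 1)) :=
  Finset.univ.filter (fun c => Monotone c ∧ c 0 = 0 ∧ c (Fin.last N) = Fin.last n)

section Cuts

variable {r n : ℕ} (u : List (Fin r)) (c : Fin (u.length + 1) → Fin (n + 1))

/-- The `j`-th letter is not the last occurrence of that letter. -/
def IsInner (j : Fin u.length) : Prop := ∃ j', j < j' ∧ u.get j' = u.get j

open Classical in
/-- The length of the `j`-th interval: the number of its steps, plus one if it is inner. -/
noncomputable def cutLen (j : Fin u.length) : ℤ :=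
  (c j.succ).1 - (c j.castSucc).1 + if IsInner u j then 1 else 0

/-- The vertices of the `t`-th factor: the intervals labelled by `t`, one after the other. -/
def cutVerts (t : Fin r) : List (Fin (n + 1)) :=
  (List.finRange u.length).flatMap (fun j =>
    if u.get j = t then
      (List.finRange (n + 1)).filter (fun a => c j.castSucc ≤ a ∧ a ≤ c j.succ)
    else [])

/-- The dimension of the `t`-th factor. -/
def cutDim (t : Fin r) : ℤ := (cutVerts u c t).length - 1

open Classical in
/-- The exponent of the sign of a cut: the sum of the right endpoints of the inner intervals, plus
the exponent of the Koszul sign for sorting the intervals by their labels. -/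
noncomputable def cutExp : ℤ :=
  (∑ j with IsInner u j, ((c j.succ).1 : ℤ)) +
    ∑ a, ∑ b with a < b ∧ u.get b < u.get a, cutLen u c a * cutLen u c b

end Cuts

section

open Simplicial

/-- The face operator given by a strictly increasing nonempty list of vertices. -/
def faceHom {n : ℕ} (L : List (Fin (n + 1))) (h : L.SortedLT) (h0 : L ≠ []) :
    ⦋L.length - 1⦌ ⟶ ⦋n⦌ :=
  SimplexCategory.Hom.mk
    { toFun := fun j => L.get (j.cast (Nat.succ_pred_eq_of_pos (List.length_pos_iff.2 h0)))
      monotone' := fun _ _ hij => h.strictMono_get.monotone hij }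

/-! ## The tensoring over simplicial sets -/

open Classical in
/-- For a family of maps indexed by simplices, the map at the face of `y` with the vertices `L`;
zero if `L` has a repetition, i.e. if that face is degenerate. -/
noncomputable def atFace {Y : SSet.{u}} {M : Type*} [Zero M] (f : ∀ n : ℕ, Y _⦋n⦌ → M)
    {n : ℕ} (y : Y _⦋n⦌) (L : List (Fin (n + 1))) : M :=
  if h : L.SortedLT ∧ L ≠ [] then f _ (Y.map (faceHom L h.1 h.2).op y) else 0

section Tensor

variable {k : Type u} [Field k]

/-- A morphism of `E_∞`-algebras `A ⟶ B^Y`, or equivalently `Y ⊗ A ⟶ B`, for a simplicial set `Y`.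

Here `B^Y = Hom(N_*(Y), B)` is the function object of `E_∞`-algebras, i.e. the limit of the
`E_∞`-algebras `N^*(Δ^n) ⊗ B` over the simplices of `Y`; the Barratt-Eccles operad acts on it
through the Alexander-Whitney diagonal of `E(r)`, the action on the chains `N_*(Y)` and the action
on `B`.  The tensoring `Y ⊗ A` is the left adjoint of `B ↦ B^Y`.  In components, a morphism
`f : A ⟶ B^Y` is a family of linear maps `f_y : A → B` of degree `n`, for the `n`-simplices `y` of
`Y`, where `f_y a` is the value of the cochain `f a` at `y`. -/
@[ext]
structure TensorHom (Y : SSet.{u}) (A B : EInftyAlg k) where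
  toFun : ∀ n : ℕ, Y _⦋n⦌ → (Tot A.X →ₗ[k] Tot B.X)
  /-- `f_y` has degree `n` -/
  map_mem : ∀ (n : ℕ) (y : Y _⦋n⦌) (e : ℤ) (a : Tot A.X), a ∈ homog A.X e →
    toFun n y a ∈ homog B.X (e + n)
  /-- the cochains are normalized -/
  map_degenerate : ∀ (n : ℕ) (y : Y _⦋n⦌), y ∈ Y.degenerate n → toFun n y = 0
  /-- compatibility with the differentials, at vertices -/
  map_d_zero : ∀ (y : Y _⦋0⦌) (a : Tot A.X), toFun 0 y (totD A.X a) = totD B.X (toFun 0 y a)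
  /-- compatibility with the differentials, where the one of `B^Y` is
  `D F = d ∘ F - (-1)^{|F|} F ∘ ∂` -/
  map_d_succ : ∀ (n : ℕ) (y : Y _⦋n + 1⦌) (e : ℤ) (a : Tot A.X), a ∈ homog A.X e →
    toFun (n + 1) y (totD A.X a) = totD B.X (toFun (n + 1) y a) -
      sgn e • ∑ l : Fin (n + 2), sgn l.1 • toFun n (Y.δ l y) a
  /-- compatibility with the operations: on `B^Y`, a generator `w` of degree `d` acts on
  `F_1, …, F_r` by the sum over `p ≤ d` of
  `± (w_p, …, w_d)_B ∘ (F_1 ⊗ … ⊗ F_r) ∘ (w_0, …, w_p)_{N_*(Y)}` with the Koszul sign -/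
  map_act : ∀ {r d : ℕ} (w : Fin (d + 1) → Arr r) (n : ℕ) (y : Y _⦋n⦌) (e : Fin r → ℤ)
    (a : Fin r → Tot A.X), (∀ t, a t ∈ homog A.X (e t)) →
    toFun n y (A.act w a) =
      ∑ p : Fin (d + 1),
        ((tableReduction (List.ofFn (fun j : Fin (p.1 + 1) => (w ⟨j, by omega⟩).1))).map
          (fun u => ∑ c ∈ cuts u.length n,
            sgn (p * ((d : ℤ) - p + ∑ t, e t) + cutExp u c +
                ∑ t, ∑ s with s < t, e t * cutDim u c s) •
              B.act (d := d - p.1) (fun j => w ⟨p + j, by omega⟩)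
                (fun t => atFace toFun y (cutVerts u c t) (a t)))).sum

end Tensor

/-! ## Principal bundles -/

/-- A principal `G`-bundle over the simplicial set `X`, for a discrete group `G`: a simplicial set
over `X` with a fibrewise right `G`-action such that all fibres, in all simplicial degrees, are
nonempty with free and transitive action. -/
structure PBun (G : Type u) [Group G] (X : SSet.{u}) where
  /-- the total space -/
  P : SSet.{u}
  /-- the projection -/
  proj : P ⟶ X
  /-- the right action -/
  ract : ∀ {n : SimplexCategoryᵒᵖ}, P.obj n → G → P.obj n
  ract_one : ∀ {n} (x : P.obj n), ract x 1 = x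
  ract_mul : ∀ {n} (x : P.obj n) (g h : G), ract x (g * h) = ract (ract x g) h
  map_ract : ∀ {n m} (α : n ⟶ m) (x : P.obj n) (g : G), P.map α (ract x g) = ract (P.map α x) g
  proj_ract : ∀ {n} (x : P.obj n) (g : G), proj.app n (ract x g) = proj.app n x
  proj_surjective : ∀ n, Function.Surjective (proj.app n)
  torsor : ∀ {n} (x y : P.obj n), proj.app n x = proj.app n y → ∃! g, ract x g = y

namespace PBun

variable {G : Type u} [Group G] {X : SSet.{u}}

/-- A morphism of principal `G`-bundles over `X`: a `G`-equivariant map over `X`. -/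
@[ext]
structure Hom (P P' : PBun G X) where
  hom : P.P ⟶ P'.P
  w : hom ≫ P'.proj = P.proj
  map_ract : ∀ {n} (x : P.P.obj n) (g : G), hom.app n (P.ract x g) = P'.ract (hom.app n x) g

instance : Category (PBun G X) where
  Hom := Hom
  id P := ⟨𝟙 _, by simp, by simp⟩
  comp f g := ⟨f.hom ≫ g.hom, by simp [f.w, g.w], by simp [f.map_ract, g.map_ract]⟩

lemma Hom.proj_app {P P' : PBun G X} (f : Hom P P') {n} (x : P.P.obj n) :
    P'.proj.app n (f.hom.app n x) = P.proj.app n x := by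
  rw [← f.w]; rfl

lemma Hom.bijective {P P' : PBun G X} (f : Hom P P') (n) : Function.Bijective (f.hom.app n) := by
  constructor
  · intro x y hxy
    obtain ⟨g, rfl, -⟩ := P.torsor x y (by rw [← f.proj_app, hxy, f.proj_app])
    rw [f.map_ract] at hxy
    have h1 := (P'.torsor (f.hom.app n x) (f.hom.app n x) rfl).unique hxy.symm (P'.ract_one _)
    rw [h1, P.ract_one]
  · intro y
    obtain ⟨x, hx⟩ := P.proj_surjective n (P'.proj.app n y)
    obtain ⟨g, hg, -⟩ := P'.torsor (f.hom.app n x) y (by rw [f.proj_app, hx])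
    exact ⟨P.ract x g, by rw [f.map_ract, hg]⟩

instance : IsGroupoid (PBun G X) where
  all_isIso {P P'} f := by
    have h : ∀ n, IsIso ((Hom.hom f).app n) := fun n =>
      (CategoryTheory.isIso_iff_bijective _).2 (Hom.bijective f n)
    have h' : IsIso (Hom.hom f) := NatIso.isIso_of_isIso_app _
    have e1 : ∀ n (x : P'.P.obj n), (Hom.hom f).app n ((inv (Hom.hom f)).app n x) = x := by
      intro n x
      have := IsIso.inv_hom_id (Hom.hom f)
      exact congrArg (fun t : P'.P ⟶ P'.P => t.app n x) this
    refine ⟨⟨inv (Hom.hom f), ?_, ?_⟩, Hom.ext ?_, Hom.ext ?_⟩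
    · rw [IsIso.inv_comp_eq]; exact f.w.symm
    · intro n x g
      apply (Hom.bijective f n).1
      rw [f.map_ract, e1, e1]
    · exact IsIso.hom_inv_id (Hom.hom f)
    · exact IsIso.inv_hom_id (Hom.hom f)

end PBun

/-- The classifying space `BG`: the nerve of the groupoid `⋆//G`. -/
abbrev BG (G : Type u) [Group G] : SSet.{u} := nerve (SingleObj G)

/-- The element of `G` on the edge from vertex `i` to vertex `j` of an `n`-simplex of `BG`. -/
def edge {G : Type u} [Group G] {n : ℕ} (c : ComposableArrows (SingleObj G) n)
    (i j : Fin (n + 1)) (h : i ≤ j) : G :=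
  c.map (homOfLE h)

/-- The total space `EG` of the universal bundle, with `n`-simplices `G^{n+1}`, on which `G` acts
by simultaneous right multiplication. -/
def EG (G : Type u) [Group G] : SSet.{u} where
  obj n := Fin (n.unop.len + 1) → G
  map α := ↾fun e i => e (α.unop.toOrderHom i)

/-- The universal bundle `EG ⟶ BG`; the edge from `i` to `j` of the image of `(e_0, …, e_n)` is
labelled by `e_j e_i⁻¹`. -/
def EG.proj (G : Type u) [Group G] : EG G ⟶ BG G where
  app n := ↾fun e =>
    { obj := fun _ => SingleObj.star G
      map := fun {i j} _ => (e j * (e i)⁻¹ : G)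
      map_id := fun i => mul_inv_cancel (e i)
      map_comp := fun {i j l} _ _ =>
        (show e l * (e i)⁻¹ = (e l * (e j)⁻¹) * (e j * (e i)⁻¹) by group) }

lemma edge_EG_proj {G : Type u} [Group G] {n : SimplexCategoryᵒᵖ} (e : (EG G).obj n) (i j h) :
    edge ((EG.proj G).app n e) i j h = e j * (e i)⁻¹ := rfl

lemma edge_comp {G : Type u} [Group G] {n : ℕ} (c : ComposableArrows (SingleObj G) n)
    (i j l : Fin (n + 1)) (h : i ≤ j) (h' : j ≤ l) :
    edge c i l (h.trans h') = edge c j l h' * edge c i j h :=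
  c.map_comp (homOfLE h) (homOfLE h')

lemma BG_ext {G : Type u} [Group G] {n : ℕ} {c c' : ComposableArrows (SingleObj G) n}
    (h : ∀ i j hij, edge c i j hij = edge c' i j hij) : c = c' := by
  refine CategoryTheory.Functor.hext (fun _ => rfl) (fun i j f => heq_of_eq ?_)
  exact h i j (leOfHom f)

/-- The pullback `φ^*EG` of the universal bundle along `φ : X ⟶ BG`. -/
def bundleOf {G : Type u} [Group G] {X : SSet.{u}} (φ : X ⟶ BG G) : PBun G X where
  P :=
    { obj := fun n => {z : X.obj n × (EG G).obj n // φ.app n z.1 = (EG.proj G).app n z.2}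
      map := fun {n m} α => ↾fun z => ⟨(X.map α z.1.1, (EG G).map α z.1.2), by
        have h1 := congrArg (fun t => t z.1.1) (φ.naturality α)
        have h2 := congrArg (fun t => t z.1.2) ((EG.proj G).naturality α)
        have h3 := congrArg (fun t => (BG G).map α t) z.2
        exact h1.trans (h3.trans h2.symm)⟩
      map_id := fun n => ConcreteCategory.hom_ext _ _ fun z => by
        apply Subtype.ext
        exact Prod.ext (Functor.map_id_apply X n z.1.1) (Functor.map_id_apply (EG G) n z.1.2)
      map_comp := fun α β => ConcreteCategory.hom_ext _ _ fun z => by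
        apply Subtype.ext
        exact Prod.ext (Functor.map_comp_apply X α β z.1.1)
          (Functor.map_comp_apply (EG G) α β z.1.2) }
  proj := { app := fun n => ↾fun z => z.1.1 }
  ract := fun z g => ⟨(z.1.1, fun i => z.1.2 i * g), z.2.trans (BG_ext fun i j h => by
    rw [edge_EG_proj, edge_EG_proj]; group)⟩
  ract_one := fun z => Subtype.ext (Prod.ext rfl (funext fun i => mul_one _))
  ract_mul := fun z g h => Subtype.ext (Prod.ext rfl (funext fun i => (mul_assoc _ _ _).symm))
  map_ract := fun α z g => rfl
  proj_ract := fun z g => rfl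
  proj_surjective := fun n x => ⟨⟨(x, fun i => edge (φ.app n x) 0 i (Fin.zero_le i)),
    BG_ext fun i j h => by
      change edge (φ.app n x) i j h =
        edge (φ.app n x) 0 j (Fin.zero_le j) * (edge (φ.app n x) 0 i (Fin.zero_le i))⁻¹
      exact eq_mul_inv_of_mul_eq (edge_comp (φ.app n x) 0 i j (Fin.zero_le i) h).symm⟩, rfl⟩
  torsor := fun {n} z z' h => by
    obtain ⟨⟨x, e⟩, he⟩ := z
    obtain ⟨⟨x', e'⟩, he'⟩ := z'
    obtain rfl : x = x' := h
    refine ⟨(e 0)⁻¹ * e' 0, Subtype.ext (Prod.ext rfl (funext fun i => ?_)), fun g hg => ?_⟩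
    · have h1 : edge ((EG.proj G).app n e) 0 i (Fin.zero_le i)
          = edge ((EG.proj G).app n e') 0 i (Fin.zero_le i) := by
        rw [show (EG.proj G).app n e = (EG.proj G).app n e' from he.symm.trans he']
      rw [edge_EG_proj, edge_EG_proj] at h1
      change e i * ((e 0)⁻¹ * e' 0) = e' i
      rw [← mul_assoc, h1]; group
    · have h1 : e 0 * g = e' 0 := congrFun (congrArg (fun z => z.1.2) hg) 0
      rw [← h1]; group

/-! ## Equivariant higher Hochschild chains -/

section Chains

variable {k : Type u} [Field k] {G : Type u} [Group G] {X : SSet.{u}}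

/-- The automorphism of the underlying algebra by which `g` acts on a `G`-equivariant
`E_∞`-algebra. -/
abbrev EquivEInftyAlg.actBy (Q : EquivEInftyAlg G k) (g : G) : Q.under ⟶ Q.under :=
  Q.map (X := SingleObj.star G) (Y := SingleObj.star G) g

/-- A cowedge from `(P × Δ^m × G^n) ⊗ Q`, as a functor of `m` (through `Δ^m`) and, contravariantly,
of `n` (through the simplicial bar construction `B_n(P, ⋆//G, Q) = (P × G^n) ⊗ Q`), to `B`.

The set `G^n` is the set of `n`-simplices `c_0 → … → c_n` of `BG`; since it is discrete, a morphism
`(P × Δ^n × G^n) ⊗ Q ⟶ B` is a family of morphisms `(P × Δ^n) ⊗ Q ⟶ B` indexed by it.  As usual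
for the two-sided bar construction of a contravariant functor `P` and a covariant functor `Q`, the
summand of `c` is formed with the value of `P` at `c_n` and the value of `Q` at `c_0`, and
`α : [m] → [n]` acts by restricting `c` along `α`, by the right action on `P` of the arrow
`c_{α(m)} → c_n`, and by the action on `Q` of the arrow `c_0 → c_{α(0)}`. -/
structure Cowedge (P : PBun G X) (Q : EquivEInftyAlg G k) (B : EInftyAlg k) where
  toHom : ∀ n : ℕ, (BG G) _⦋n⦌ → TensorHom (P.P ⊗ Δ[n]) Q.under B
  w : ∀ {m n : ℕ} (α : ⦋m⦌ ⟶ ⦋n⦌) (c : (BG G) _⦋n⦌) (l : ℕ) (p : P.P _⦋l⦌)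
    (s : (Δ[m] : SSet.{u}) _⦋l⦌),
    (toHom n c).toFun l (p, (SSet.stdSimplex.map α).app _ s) =
      (toHom m ((BG G).map α.op c)).toFun l
          (P.ract p (edge c (α.toOrderHom (Fin.last m)) (Fin.last n) (Fin.le_last _)), s) ∘ₗ
        totMap (Q.actBy (edge c 0 (α.toOrderHom 0) (Fin.zero_le _))).hom

/-- The derived tensor product `P ⊗_G A`, computed with the cofibrant replacement `Q` of `A`: an
`E_∞`-algebra together with a universal cowedge, i.e. the coend `∫^n (P × Δ^n × G^n) ⊗ Q`. -/
structure Chains (P : PBun G X) (Q : EquivEInftyAlg G k) where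
  obj : EInftyAlg k
  cowedge : Cowedge P Q obj
  existsUnique_desc : ∀ (B : EInftyAlg k) (v : Cowedge P Q B), ∃! f : obj ⟶ B,
    ∀ (n : ℕ) (c : (BG G) _⦋n⦌) (l : ℕ) (y : (P.P ⊗ Δ[n]) _⦋l⦌),
      (v.toHom n c).toFun l y = totMap f.hom ∘ₗ (cowedge.toHom n c).toFun l y

/-- The `G`-equivariant higher Hochschild chains `∫_φ A = φ^*EG ⊗_G A` of `φ : X ⟶ BG`, computed
with the cofibrant replacement `Q` of `A`. -/
abbrev HochschildChains (φ : X ⟶ BG G) (Q : EquivEInftyAlg G k) := Chains (bundleOf φ) Q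

/-- `F` is the morphism `f ⊗_G A : P ⊗_G A ⟶ P' ⊗_G A`, i.e. the one that is induced on coends by
the maps `f × id × id` from `P × Δ^n × G^n` to `P' × Δ^n × G^n`. -/
def Chains.IsInduced {P P' : PBun G X} {Q : EquivEInftyAlg G k} (H : Chains P Q)
    (H' : Chains P' Q) (f : P ⟶ P') (F : H.obj ⟶ H'.obj) : Prop :=
  ∀ (n : ℕ) (c : (BG G) _⦋n⦌) (l : ℕ) (p : P.P _⦋l⦌) (s : (Δ[n] : SSet.{u}) _⦋l⦌),
    totMap F.hom ∘ₗ (H.cowedge.toHom n c).toFun l (p, s) =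
      (H'.cowedge.toHom n c).toFun l (f.hom.app _ p, s)

end Chains

end

end EqHH

/-! Morphisms out of the coend are the same as cowedges, so everything except existence is formal. A
bundle map `f : P ⟶ P'` turns a cowedge from `P'` into one from `P` (`Cowedge.precomp`); its
equivariance is what keeps the cowedge identity. The universal property therefore gives exactly one
induced morphism (`Chains.existsUnique_isInduced`). Uniqueness forces compatibility with identities
and composites, hence the functor, the isomorphisms and the action of the bundle automorphisms.

Existence is a solution-set argument. In the product of the algebras `B` over all pairs of an
algebra `B` and a cowedge `v` to it, take the subalgebra generated by the values of the cowedges.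
The product is too large for the universe `u`, but the subalgebra is the image of a `u`-small type
of formal expressions (`Term`), so it can be shrunk into `u`.

All identities are checked factor by factor: those of an algebra in `EInftyAlg.ofJointlyInjective`,
those of a morphism from a tensor product in `TensorHom.ofJointlyInjective`. The projection to the
factor of `(B, v)` is the morphism induced by `v`, and it is the only one because the subalgebra is
generated by values (`valueAlg_hom_ext`). -/

namespace EqHH

/-! ### Structure inherited by subcomplexes of products of algebras. -/

section Transfer

variable {k : Type u} [Field k]

lemma totMap_apply {X Y : ChainComplex (ModuleCat.{u} k) ℤ} (f : X ⟶ Y) (x : Tot X) (i : ℤ) :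
    totMap f x i = (f.f i).hom (x i) :=
  DirectSum.lmap_apply _ _ _

lemma totMap_lof {X Y : ChainComplex (ModuleCat.{u} k) ℤ} (f : X ⟶ Y) (i : ℤ) (x : X.X i) :
    totMap f (DirectSum.lof k ℤ (fun i => X.X i) i x) =
      DirectSum.lof k ℤ (fun i => Y.X i) i ((f.f i).hom x) :=
  DirectSum.lmap_lof _ _ _

lemma totD_lof (X : ChainComplex (ModuleCat.{u} k) ℤ) (i : ℤ) (x : X.X i) :
    totD X (DirectSum.lof k ℤ (fun i => X.X i) i x) =
      DirectSum.lof k ℤ (fun i => X.X i) (i - 1) ((X.d i (i - 1)).hom x) := by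
  simp [totD]

lemma totMap_totD {X Y : ChainComplex (ModuleCat.{u} k) ℤ} (f : X ⟶ Y) (x : Tot X) :
    totMap f (totD X x) = totD Y (totMap f x) := by
  refine LinearMap.congr_fun (f := totMap f ∘ₗ totD X) (g := totD Y ∘ₗ totMap f) ?_ x
  refine DirectSum.linearMap_ext _ fun i => LinearMap.ext fun y => ?_
  simp only [LinearMap.comp_apply, totD_lof, totMap_lof]
  congr 1
  exact (LinearMap.congr_fun (congrArg ModuleCat.Hom.hom (f.comm i (i - 1))) y).symm

lemma lof_mem_homog (X : ChainComplex (ModuleCat.{u} k) ℤ) (i : ℤ) (x : X.X i) :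
    DirectSum.lof k ℤ (fun i => X.X i) i x ∈ homog X i :=
  ⟨x, rfl⟩

lemma mem_homog_iff {X : ChainComplex (ModuleCat.{u} k) ℤ} {i : ℤ} {x : Tot X} :
    x ∈ homog X i ↔ ∀ j, j ≠ i → x j = 0 := by
  constructor
  · rintro ⟨y, rfl⟩ j hj
    exact DirectSum.of_eq_of_ne (β := fun i => X.X i) i j y hj
  · intro h
    refine ⟨x i, DFinsupp.ext fun j => ?_⟩
    by_cases hj : j = i
    · subst hj; exact DirectSum.of_eq_same j _
    · rw [h j hj]; exact DirectSum.of_eq_of_ne i j _ hj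

lemma lof_apply_of_mem_homog {X : ChainComplex (ModuleCat.{u} k) ℤ} {i : ℤ} {x : Tot X}
    (hx : x ∈ homog X i) : DirectSum.lof k ℤ (fun i => X.X i) i (x i) = x := by
  obtain ⟨y, rfl⟩ := hx
  rw [DirectSum.lof_apply]

lemma totMap_mem_homog {X Y : ChainComplex (ModuleCat.{u} k) ℤ} (f : X ⟶ Y) {i : ℤ} {x : Tot X}
    (hx : x ∈ homog X i) : totMap f x ∈ homog Y i := by
  rw [mem_homog_iff] at hx ⊢
  intro j hj
  rw [totMap_apply, hx j hj, map_zero]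

lemma totMap_units_smul {X Y : ChainComplex (ModuleCat.{u} k) ℤ} (f : X ⟶ Y) (s : ℤˣ)
    (x : Tot X) : totMap f (s • x) = s • totMap f x := by
  rw [Units.smul_def, Units.smul_def, map_zsmul]

variable {J : Type*} {X : ChainComplex (ModuleCat.{u} k) ℤ} {B : J → EInftyAlg k}

/-- The chain maps from `X` are jointly injective. -/
def JointlyInjective (π : ∀ j, X ⟶ (B j).X) : Prop :=
  ∀ (i : ℤ) (x y : X.X i), (∀ j, ((π j).f i).hom x = ((π j).f i).hom y) → x = y

variable {π : ∀ j, X ⟶ (B j).X}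

lemma JointlyInjective.ext (hπ : JointlyInjective π) {x y : Tot X}
    (h : ∀ j, totMap (π j) x = totMap (π j) y) : x = y :=
  DFinsupp.ext fun i => hπ i _ _ fun j => by
    rw [← totMap_apply, ← totMap_apply, h]

/-- The components of `x` outside degree `i` are killed by every projection, hence vanish. -/
lemma JointlyInjective.mem_homog (hπ : JointlyInjective π) {i : ℤ} {x : Tot X}
    (h : ∀ j, totMap (π j) x ∈ homog (B j).X i) : x ∈ homog X i := by
  rw [mem_homog_iff]
  intro i' hi'
  refine hπ _ _ _ fun j => ?_
  rw [← totMap_apply, mem_homog_iff.1 (h j) i' hi', map_zero]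

/-- A complex with operations that embeds into a product of `E_∞`-algebras is an
`E_∞`-algebra. -/
noncomputable def EInftyAlg.ofJointlyInjective (hπ : JointlyInjective π)
    (act : ∀ {r d : ℕ}, (Fin (d + 1) → Arr r) → MultilinearMap k (fun _ : Fin r => Tot X) (Tot X))
    (hact : ∀ {r d : ℕ} (w : Fin (d + 1) → Arr r) (x : Fin r → Tot X) (j : J),
      totMap (π j) (act w x) = (B j).act w (fun t => totMap (π j) (x t))) : EInftyAlg k where
  X := X
  act := act
  act_mem w e x hx := hπ.mem_homog fun j => by
    rw [hact]
    exact (B j).act_mem w e _ fun t => totMap_mem_homog _ (hx t)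
  act_degenerate w l hl := MultilinearMap.ext fun x => hπ.ext fun j => by
    rw [hact, (B j).act_degenerate w l hl]
    simp
  act_d_zero w e x hx := hπ.ext fun j => by
    rw [totMap_totD, hact, (B j).act_d_zero w e _ fun t => totMap_mem_homog _ (hx t), map_sum]
    refine Finset.sum_congr rfl fun t _ => ?_
    rw [totMap_units_smul, hact]
    congr 2
    funext s
    by_cases h : s = t
    · subst h; simp [totMap_totD]
    · simp [h]
  act_d_succ w e x hx := hπ.ext fun j => by
    rw [totMap_totD, hact, (B j).act_d_succ w e _ fun t => totMap_mem_homog _ (hx t), map_add,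
      totMap_units_smul, map_sum, map_sum]
    congr 1
    · refine Finset.sum_congr rfl fun t _ => ?_
      rw [totMap_units_smul, hact]
    · congr 1
      refine Finset.sum_congr rfl fun t _ => ?_
      rw [totMap_units_smul, hact]
      congr 2
      funext s
      by_cases h : s = t
      · subst h; simp [totMap_totD]
      · simp [h]
  act_relabel w σ e x hx := hπ.ext fun j => by
    rw [hact, (B j).act_relabel w σ e _ fun t => totMap_mem_homog _ (hx t), totMap_units_smul,
      hact]
  act_one x := hπ.ext fun j => by rw [hact, (B j).act_one]
  act_comp i w v e x hx := hπ.ext fun j => by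
    rw [map_sum, totMap_units_smul, hact]
    -- Projections preserve degrees, so the Koszul sign, which depends only on `e`, is the same in
    -- every factor.
    have h := (B j).act_comp i w v e _ fun t => totMap_mem_homog (π j) (hx t)
    simp only [totMap_units_smul, hact]
    rw [h]
    congr 2
    funext t
    split_ifs
    · rw [hact]
    · rfl

end Transfer

/-! ## Algebras generated by the values of a family of valuations -/

/-- Formal expressions of a given degree in generators from `I`. -/
inductive Term (k : Type u) (I : Type u) : ℤ → Type u
  | gen (j : I) (i : ℤ) : Term k I i
  | zero (i : ℤ) : Term k I i
  | add {i : ℤ} (s t : Term k I i) : Term k I i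
  | smul {i : ℤ} (c : k) (t : Term k I i) : Term k I i
  -- In `diff` and `act` the target degree is a free parameter, which avoids transport along
  -- equalities of integers; in a wrong degree the value is zero.
  | diff {i : ℤ} (j : ℤ) (t : Term k I i) : Term k I j
  | act {r d : ℕ} (w : Fin (d + 1) → Arr r) (e : Fin r → ℤ) (x : ∀ t, Term k I (e t)) (i : ℤ) :
      Term k I i

section Generated

variable {k : Type u} [Field k] {I : Type u}

/-- The value of a formal expression in an `E_∞`-algebra. -/
noncomputable def Term.eval (B : EInftyAlg k) (v : I → Tot B.X) :
    ∀ {i : ℤ}, Term k I i → B.X.X i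
  | _, .gen j i => v j i
  | _, .zero _ => 0
  | _, .add s t => s.eval B v + t.eval B v
  | _, .smul c t => c • t.eval B v
  | _, .diff (i := i) j t => (B.X.d i j).hom (t.eval B v)
  | _, .act w e x i =>
      B.act w (fun t => DirectSum.lof k ℤ (fun i => B.X.X i) (e t) ((x t).eval B v)) i

variable {V : EInftyAlg k → Type u} (val : ∀ B, V B → I → Tot B.X)

/-- The families of values, in all algebras at once, of the formal expressions of degree `i`. -/
noncomputable def valueModule (i : ℤ) : Submodule k (∀ p : Σ B, V B, p.1.X.X i) where
  carrier := Set.range fun (t : Term k I i) p => t.eval p.1 (val p.1 p.2)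
  add_mem' := by
    rintro _ _ ⟨s, rfl⟩ ⟨t, rfl⟩
    exact ⟨.add s t, rfl⟩
  zero_mem' := ⟨.zero i, rfl⟩
  smul_mem' := by
    rintro c _ ⟨t, rfl⟩
    exact ⟨.smul c t, rfl⟩

/-- The ambient product is indexed by all algebras, a type in a higher universe, but the submodule
is the range of a function on expressions, which lie in `Type u`. -/
instance (i : ℤ) : Small.{u} (valueModule val i) :=
  small_range fun (t : Term k I i) (p : Σ B, V B) => t.eval p.1 (val p.1 p.2)

/-- The value of an element in the algebra of `p`. -/
noncomputable def valueAt (p : Σ B, V B) (i : ℤ) :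
    Shrink.{u} (valueModule val i) →ₗ[k] p.1.X.X i :=
  LinearMap.proj p ∘ₗ (valueModule val i).subtype ∘ₗ (Shrink.linearEquiv k _).toLinearMap

/-- The element given by a formal expression. -/
noncomputable def Term.toValue {i : ℤ} (t : Term k I i) : Shrink.{u} (valueModule val i) :=
  (Shrink.linearEquiv k _).symm ⟨fun p => t.eval p.1 (val p.1 p.2), t, rfl⟩

lemma valueAt_toValue (p : Σ B, V B) {i : ℤ} (t : Term k I i) :
    valueAt val p i (t.toValue val) = t.eval p.1 (val p.1 p.2) := by
  simp [valueAt, Term.toValue]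

lemma Term.toValue_surjective (i : ℤ) :
    Function.Surjective (Term.toValue val : Term k I i → _) := by
  intro x
  obtain ⟨t, ht⟩ := ((Shrink.linearEquiv k _) x).2
  refine ⟨t, ?_⟩
  rw [Term.toValue, LinearEquiv.symm_apply_eq]
  exact Subtype.ext ht

lemma value_ext {i : ℤ} {x y : Shrink.{u} (valueModule val i)}
    (h : ∀ p, valueAt val p i x = valueAt val p i y) : x = y :=
  (Shrink.linearEquiv k _).injective (Subtype.ext (funext h))

/-- Differentiating all values of `t` gives the values of `Term.diff j t`, so the submodules are
closed under the differentials. -/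
lemma exists_value_d (i j : ℤ) (x : Shrink.{u} (valueModule val i)) :
    ∃ y : Shrink.{u} (valueModule val j),
      ∀ p, valueAt val p j y = (p.1.X.d i j).hom (valueAt val p i x) := by
  obtain ⟨t, rfl⟩ := Term.toValue_surjective val i x
  exact ⟨(Term.diff j t).toValue val, fun p => by simp only [valueAt_toValue]; rfl⟩

/-- The differential on values. -/
noncomputable def valueD (i j : ℤ) :
    Shrink.{u} (valueModule val i) →ₗ[k] Shrink.{u} (valueModule val j) where
  -- The choice is forced, since an element is determined by its values; linearity follows from
  -- linearity in each factor.
  toFun x := (exists_value_d val i j x).choose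
  map_add' x y := value_ext val fun p => by
    rw [map_add, (exists_value_d val i j (x + y)).choose_spec p,
      (exists_value_d val i j x).choose_spec p, (exists_value_d val i j y).choose_spec p,
      map_add, map_add]
  map_smul' c x := value_ext val fun p => by
    rw [map_smul, (exists_value_d val i j (c • x)).choose_spec p,
      (exists_value_d val i j x).choose_spec p, map_smul, map_smul, RingHom.id_apply]

lemma valueAt_valueD (p : Σ B, V B) (i j : ℤ) (x : Shrink.{u} (valueModule val i)) :
    valueAt val p j (valueD val i j x) = (p.1.X.d i j).hom (valueAt val p i x) :=
  (exists_value_d val i j x).choose_spec p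

/-- The complex of values of formal expressions. -/
noncomputable def valueComplex : ChainComplex (ModuleCat.{u} k) ℤ where
  X i := ModuleCat.of k (Shrink.{u} (valueModule val i))
  d i j := ModuleCat.ofHom (valueD val i j)
  shape i j hij := ModuleCat.hom_ext <| LinearMap.ext fun x => value_ext val fun p => by
    change valueAt val p j (valueD val i j x) = valueAt val p j 0
    rw [valueAt_valueD, p.1.X.shape i j hij, map_zero]
    rfl
  d_comp_d' i j l _ _ := ModuleCat.hom_ext <| LinearMap.ext fun x => value_ext val fun p => by
    change valueAt val p l (valueD val j l (valueD val i j x)) = valueAt val p l 0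
    rw [valueAt_valueD, valueAt_valueD, map_zero]
    exact LinearMap.congr_fun (congrArg ModuleCat.Hom.hom (p.1.X.d_comp_d i j l)) _

/-- The projection from the complex of values to the algebra of `p`. -/
noncomputable def valueProj (p : Σ B, V B) : valueComplex val ⟶ p.1.X where
  f i := ModuleCat.ofHom (valueAt val p i)
  comm' i j _ := ModuleCat.hom_ext <| LinearMap.ext fun x => (valueAt_valueD val p i j x).symm

lemma jointlyInjective_valueProj : JointlyInjective (valueProj val) :=
  fun _ _ _ h => value_ext val h

/-- The element of the total space given by a formal expression. -/
noncomputable def Term.toTot {i : ℤ} (t : Term k I i) : Tot (valueComplex val) :=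
  DirectSum.lof k ℤ (fun i => (valueComplex val).X i) i (t.toValue val)

lemma totMap_valueProj_toTot (p : Σ B, V B) {i : ℤ} (t : Term k I i) :
    totMap (valueProj val p) (t.toTot val) =
      DirectSum.lof k ℤ (fun i => p.1.X.X i) i (t.eval p.1 (val p.1 p.2)) := by
  refine (totMap_lof (valueProj val p) i (t.toValue val)).trans ?_
  congr 1
  exact valueAt_toValue val p t

lemma tot_eq_sum_terms (x : Tot (valueComplex val)) :
    ∃ t : ∀ i, Term k I i, ∃ S : Finset ℤ, x = ∑ i ∈ S, (t i).toTot val := by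
  classical
  choose t ht using fun i => Term.toValue_surjective val i (x i)
  refine ⟨t, DFinsupp.support x, ?_⟩
  have h := DirectSum.sum_support_of x
  refine h.symm.trans (Finset.sum_congr rfl fun i _ => ?_)
  rw [Term.toTot, ht]
  rfl

/-- An operation on homogeneous arguments lands in degree `d + ∑ t, e t`, so taking that one
component loses nothing. -/
lemma totMap_valueProj_act (p : Σ B, V B) {r d : ℕ} (w : Fin (d + 1) → Arr r) (e : Fin r → ℤ)
    (x : ∀ t, Term k I (e t)) :
    totMap (valueProj val p) ((Term.act w e x (d + ∑ t, e t)).toTot val) =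
      p.1.act w (fun t => totMap (valueProj val p) ((x t).toTot val)) := by
  simp only [totMap_valueProj_toTot]
  exact lof_apply_of_mem_homog (p.1.act_mem w e _ fun t => lof_mem_homog _ _ _)

lemma exists_value_act {r d : ℕ} (w : Fin (d + 1) → Arr r)
    (x : Fin r → Tot (valueComplex val)) :
    ∃ y : Tot (valueComplex val), ∀ p, totMap (valueProj val p) y =
      p.1.act w (fun t => totMap (valueProj val p) (x t)) := by
  classical
  choose t S h using fun a => tot_eq_sum_terms val (x a)
  -- Multilinear expansion: `e` picks one homogeneous summand of each argument.
  refine ⟨∑ e ∈ Fintype.piFinset S,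
    (Term.act w e (fun a => t a (e a)) (d + ∑ a, e a)).toTot val, fun p => ?_⟩
  simp only [map_sum, totMap_valueProj_act]
  conv_rhs => simp only [h, map_sum]
  rw [MultilinearMap.map_sum_finset]

/-- The operations on values. -/
noncomputable def valueAct {r d : ℕ} (w : Fin (d + 1) → Arr r) :
    MultilinearMap k (fun _ : Fin r => Tot (valueComplex val)) (Tot (valueComplex val)) where
  toFun x := (exists_value_act val w x).choose
  map_update_add' {inst} x a y z := (jointlyInjective_valueProj val).ext fun p => by
    -- The field of `MultilinearMap` quantifies over all decidable equalities on `Fin r`; it is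
    -- identified with the standard one.
    obtain rfl := Subsingleton.elim inst (instDecidableEqFin r)
    have h : ∀ y, (fun t => totMap (valueProj val p) (Function.update x a y t)) =
        Function.update (fun t => totMap (valueProj val p) (x t)) a
          (totMap (valueProj val p) y) := fun y =>
      funext fun t => Function.apply_update (fun _ => totMap (valueProj val p)) x a y t
    simp only [map_add, (exists_value_act val w _).choose_spec p, h,
      MultilinearMap.map_update_add]
  map_update_smul' {inst} x a c y := (jointlyInjective_valueProj val).ext fun p => by
    obtain rfl := Subsingleton.elim inst (instDecidableEqFin r)
    have h : ∀ y, (fun t => totMap (valueProj val p) (Function.update x a y t)) =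
        Function.update (fun t => totMap (valueProj val p) (x t)) a
          (totMap (valueProj val p) y) := fun y =>
      funext fun t => Function.apply_update (fun _ => totMap (valueProj val p)) x a y t
    simp only [map_smul, (exists_value_act val w _).choose_spec p, h,
      MultilinearMap.map_update_smul]

lemma totMap_valueAct {r d : ℕ} (w : Fin (d + 1) → Arr r) (x : Fin r → Tot (valueComplex val))
    (p : Σ B, V B) : totMap (valueProj val p) (valueAct val w x) =
      p.1.act w (fun t => totMap (valueProj val p) (x t)) :=
  (exists_value_act val w x).choose_spec p

/-- The `E_∞`-algebra of values of formal expressions. -/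
noncomputable def valueAlg : EInftyAlg k :=
  EInftyAlg.ofJointlyInjective (jointlyInjective_valueProj val) (valueAct val)
    (totMap_valueAct val)

/-- The projections from the algebra of values. -/
noncomputable def valueHom (p : Σ B, V B) : valueAlg val ⟶ p.1 :=
  ⟨valueProj val p, fun w x => totMap_valueAct val w x p⟩

/-- Every element is a sum of values of expressions, and morphisms commute with each way of forming
expressions; so induction on expressions reduces equality to the generators. -/
lemma valueAlg_hom_ext {C : EInftyAlg k} (f g : valueAlg val ⟶ C)
    (h : ∀ (j : I) (i : ℤ), totMap f.hom ((Term.gen j i).toTot val) =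
      totMap g.hom ((Term.gen j i).toTot val)) : f = g := by
  have key : ∀ {i : ℤ} (t : Term k I i),
      totMap f.hom (t.toTot val) = totMap g.hom (t.toTot val) := by
    intro i t
    induction t with
    | gen j i => exact h j i
    | zero i =>
      have e : (Term.zero i : Term k I i).toTot val = 0 :=
        (jointlyInjective_valueProj val).ext fun p => by
          rw [totMap_valueProj_toTot, map_zero]
          exact map_zero _
      rw [e]
      exact (map_zero (totMap f.hom)).trans (map_zero (totMap g.hom)).symm
    | add s t hs ht =>
      have e : (Term.add s t).toTot val = s.toTot val + t.toTot val :=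
        (jointlyInjective_valueProj val).ext fun p => by
          simp only [map_add, totMap_valueProj_toTot]
          exact map_add _ _ _
      rw [e]
      exact (map_add _ _ _).trans ((congrArg₂ _ hs ht).trans (map_add _ _ _).symm)
    | smul c t ht =>
      have e : (Term.smul c t).toTot val = c • t.toTot val :=
        (jointlyInjective_valueProj val).ext fun p => by
          simp only [map_smul, totMap_valueProj_toTot]
          exact map_smul _ _ _
      rw [e]
      exact (map_smul _ _ _).trans ((congrArg _ ht).trans (map_smul _ _ _).symm)
    | @diff i j t ht =>
      by_cases hij : j = i - 1
      · subst hij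
        have e : (Term.diff (i - 1) t).toTot val = totD (valueComplex val) (t.toTot val) :=
          (jointlyInjective_valueProj val).ext fun p => by
            simp only [totMap_totD, totMap_valueProj_toTot, totD_lof]
            rfl
        rw [e]
        exact (totMap_totD f.hom _).trans ((congrArg _ ht).trans (totMap_totD g.hom _).symm)
      · have e : (Term.diff j t).toTot val = 0 :=
          (jointlyInjective_valueProj val).ext fun p => by
            rw [totMap_valueProj_toTot, map_zero]
            have hd : p.1.X.d i j = 0 := p.1.X.shape i j fun h => hij (by
              have : j + 1 = i := h
              omega)
            change DirectSum.lof k ℤ (fun i => p.1.X.X i) j ((p.1.X.d i j).hom _) = 0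
            rw [hd]
            exact map_zero _
        rw [e]
        exact (map_zero (totMap f.hom)).trans (map_zero (totMap g.hom)).symm
    | @act r d w e x i hx =>
      by_cases hi : i = d + ∑ t, e t
      · subst hi
        have e' : (Term.act w e x (d + ∑ t, e t)).toTot val =
            (valueAlg val).act w (fun t => (x t).toTot val) :=
          (jointlyInjective_valueProj val).ext fun p =>
            (totMap_valueProj_act val p w e x).trans (totMap_valueAct val w _ p).symm
        rw [e']
        exact (f.map_act w _).trans ((congrArg _ (funext hx)).trans (g.map_act w _).symm)
      · have e' : (Term.act w e x i).toTot val = 0 :=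
          (jointlyInjective_valueProj val).ext fun p => by
            rw [totMap_valueProj_toTot, map_zero]
            have h0 := mem_homog_iff.1
              (p.1.act_mem w e _ fun t => lof_mem_homog _ _ ((x t).eval p.1 (val p.1 p.2))) i hi
            exact (congrArg _ h0).trans (map_zero _)
        rw [e']
        exact (map_zero (totMap f.hom)).trans (map_zero (totMap g.hom)).symm
  refine EInftyAlg.Hom.ext (HomologicalComplex.hom_ext _ _ fun i => ModuleCat.hom_ext <|
    LinearMap.ext fun x => ?_)
  obtain ⟨t, rfl⟩ := Term.toValue_surjective val i x
  -- Equality in the total space descends to degree `i` because the inclusion of that summand is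
  -- injective.
  have h1 := (totMap_lof f.hom i (t.toValue val)).symm.trans
    ((key t).trans (totMap_lof g.hom i (t.toValue val)))
  exact DirectSum.of_injective (β := fun i => C.X.X i) i h1

end Generated

open Simplicial

/-! ### Morphisms out of tensor products: detection by projections, and restriction. -/

section TensorHoms

variable {k : Type u} [Field k]

/-- A family of linear maps to a subalgebra of a product of `E_∞`-algebras is a morphism from the
tensor product if its components are. -/
noncomputable def TensorHom.ofJointlyInjective {J : Type*} {Y : SSet.{u}} {A C : EInftyAlg k}
    {B : J → EInftyAlg k} {π : ∀ j, C ⟶ B j} (hπ : JointlyInjective fun j => (π j).hom)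
    (φ : ∀ j, TensorHom Y A (B j)) (F : ∀ n : ℕ, Y _⦋n⦌ → (Tot A.X →ₗ[k] Tot C.X))
    (hF : ∀ j n y a, totMap (π j).hom (F n y a) = (φ j).toFun n y a) : TensorHom Y A C where
  toFun := F
  map_mem n y e a ha := hπ.mem_homog fun j => by
    rw [hF]; exact (φ j).map_mem n y e a ha
  map_degenerate n y hy := LinearMap.ext fun a => hπ.ext fun j => by
    rw [hF, (φ j).map_degenerate n y hy]; simp
  map_d_zero y a := hπ.ext fun j => by
    rw [hF, (φ j).map_d_zero, totMap_totD, hF]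
  map_d_succ n y e a ha := hπ.ext fun j => by
    rw [hF, (φ j).map_d_succ n y e a ha, map_sub, totMap_totD, hF, totMap_units_smul, map_sum]
    simp only [totMap_units_smul, hF]
  map_act w n y e a ha := hπ.ext fun j => by
    -- Whether a face is degenerate depends only on `L`, so projections commute with evaluation at
    -- faces.
    have hat : ∀ (L : List (Fin (n + 1))) (b : Tot A.X),
        totMap (π j).hom (atFace F y L b) = atFace (φ j).toFun y L b := by
      intro L b
      unfold atFace
      split_ifs
      · exact hF _ _ _ _
      · simp
    rw [hF, (φ j).map_act w n y e a ha, map_sum]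
    refine Finset.sum_congr rfl fun p _ => ?_
    rw [map_list_sum, List.map_map]
    congr 2
    funext u
    simp only [Function.comp_apply]
    rw [map_sum]
    refine Finset.sum_congr rfl fun c _ => ?_
    rw [totMap_units_smul, (π j).map_act]
    simp only [hat]

/-- The restriction of a morphism from the tensor product along a map of simplicial sets. -/
noncomputable def TensorHom.precomp {Y Y' : SSet.{u}} {A B : EInftyAlg k} (g : Y ⟶ Y')
    (φ : TensorHom Y' A B) : TensorHom Y A B where
  toFun n y := φ.toFun n (g.app _ y)
  map_mem n y := φ.map_mem n _
  map_degenerate n y hy := φ.map_degenerate n _ (SSet.degenerate_app_apply hy g)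
  map_d_zero y := φ.map_d_zero _
  map_d_succ n y e a ha := by
    rw [φ.map_d_succ n _ e a ha]
    congr 2
    refine Finset.sum_congr rfl fun l _ => ?_
    rw [SSet.δ_naturality_apply]
  map_act w n y e a ha := by
    -- Faces are natural in the simplicial set, so each term of the operation formula is carried
    -- along `g`.
    have hat : ∀ L : List (Fin (n + 1)), atFace (fun n y => φ.toFun n (g.app _ y)) y L =
        atFace φ.toFun (g.app _ y) L := by
      intro L
      unfold atFace
      split_ifs
      · exact congrArg _ (NatTrans.naturality_apply g _ y)
      · rfl
    rw [φ.map_act w n _ e a ha]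
    simp only [hat]

end TensorHoms

/-! ### Construction of the coend and its universal property. -/

section Coend

variable {k : Type u} [Field k] {G : Type u} [Group G] {X : SSet.{u}} (P : PBun G X)
  (Q : EquivEInftyAlg G k)

/-- The generators of the coend: simplices of `P × Δ^n × G^n`, together with homogeneous elements
of `Q`. -/
structure CoendGen where
  n : ℕ
  c : (BG G) _⦋n⦌
  l : ℕ
  y : (P.P ⊗ Δ[n]) _⦋l⦌
  e : ℤ
  a : Q.under.X.X e

variable {P Q}

/-- The value of a cowedge at a generator. -/
noncomputable def Cowedge.genValue (B : EInftyAlg k) (v : Cowedge P Q B) (j : CoendGen P Q) :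
    Tot B.X :=
  (v.toHom j.n j.c).toFun j.l j.y (DirectSum.lof k ℤ (fun i => Q.under.X.X i) j.e j.a)

lemma Cowedge.genValue_mem {B : EInftyAlg k} (v : Cowedge P Q B) (j : CoendGen P Q) :
    v.genValue B j ∈ homog B.X (j.e + j.l) :=
  (v.toHom j.n j.c).map_mem _ _ _ _ (lof_mem_homog _ _ _)

lemma totMap_valueProj_gen (p : Σ B : EInftyAlg k, Cowedge P Q B) (j : CoendGen P Q) :
    totMap (valueProj Cowedge.genValue p) ((Term.gen j (j.e + j.l)).toTot Cowedge.genValue) =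
      p.2.genValue p.1 j := by
  rw [totMap_valueProj_toTot]
  exact lof_apply_of_mem_homog (p.2.genValue_mem j)

/-- Cowedge components raise degree by `l`, so a generator has values only in degree `j.e + j.l`.
This disposes of the other degrees in which `valueAlg_hom_ext` tests generators. -/
lemma toTot_gen_of_ne (j : CoendGen P Q) {i : ℤ} (hi : i ≠ j.e + j.l) :
    (Term.gen j i : Term k _ i).toTot (V := Cowedge P Q) Cowedge.genValue = 0 :=
  (jointlyInjective_valueProj _).ext fun p => by
    rw [totMap_valueProj_toTot, map_zero]
    exact (congrArg _ (mem_homog_iff.1 (p.2.genValue_mem j) i hi)).trans (map_zero _)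

variable (P Q)

lemma exists_coend_value (n : ℕ) (c : (BG G) _⦋n⦌) (l : ℕ) (y : (P.P ⊗ Δ[n]) _⦋l⦌)
    (a : Tot Q.under.X) :
    ∃ z : Tot (valueComplex (V := Cowedge P Q) Cowedge.genValue),
      ∀ p, totMap (valueProj Cowedge.genValue p) z = (p.2.toHom n c).toFun l y a := by
  classical
  -- Generators carry homogeneous elements only, so `a` is split into its components.
  refine ⟨∑ e ∈ DFinsupp.support a, (Term.gen (⟨n, c, l, y, e, a e⟩ : CoendGen P Q)
    (e + l)).toTot Cowedge.genValue, fun p => ?_⟩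
  rw [map_sum]
  conv_rhs => rw [← DirectSum.sum_support_of a, map_sum]
  exact Finset.sum_congr rfl fun e _ => totMap_valueProj_gen p ⟨n, c, l, y, e, a e⟩

/-- The components of the universal cowedge. -/
noncomputable def coendMap (n : ℕ) (c : (BG G) _⦋n⦌) (l : ℕ) (y : (P.P ⊗ Δ[n]) _⦋l⦌) :
    Tot Q.under.X →ₗ[k] Tot (valueComplex (V := Cowedge P Q) Cowedge.genValue) where
  toFun a := (exists_coend_value P Q n c l y a).choose
  map_add' a b := (jointlyInjective_valueProj _).ext fun p => by
    rw [map_add, (exists_coend_value P Q n c l y (a + b)).choose_spec p,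
      (exists_coend_value P Q n c l y a).choose_spec p,
      (exists_coend_value P Q n c l y b).choose_spec p, map_add]
  map_smul' s a := (jointlyInjective_valueProj _).ext fun p => by
    rw [map_smul, (exists_coend_value P Q n c l y (s • a)).choose_spec p,
      (exists_coend_value P Q n c l y a).choose_spec p, map_smul, RingHom.id_apply]

lemma totMap_coendMap (p : Σ B : EInftyAlg k, Cowedge P Q B) (n : ℕ) (c : (BG G) _⦋n⦌) (l : ℕ)
    (y : (P.P ⊗ Δ[n]) _⦋l⦌) (a : Tot Q.under.X) :
    totMap (valueProj Cowedge.genValue p) (coendMap P Q n c l y a) =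
      (p.2.toHom n c).toFun l y a :=
  (exists_coend_value P Q n c l y a).choose_spec p

/-- This ties the universal cowedge to the generators: a morphism prescribed on the cowedge is
prescribed on every `Term.gen` in its proper degree. -/
lemma coendMap_lof (j : CoendGen P Q) :
    coendMap P Q j.n j.c j.l j.y (DirectSum.lof k ℤ (fun i => Q.under.X.X i) j.e j.a) =
      (Term.gen j (j.e + j.l)).toTot Cowedge.genValue :=
  (jointlyInjective_valueProj _).ext fun p =>
    (totMap_coendMap P Q p _ _ _ _ _).trans (totMap_valueProj_gen p j).symm

/-- The universal cowedge. -/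
noncomputable def coendCowedge :
    Cowedge P Q (valueAlg (V := Cowedge P Q) Cowedge.genValue) where
  toHom n c := TensorHom.ofJointlyInjective (π := valueHom Cowedge.genValue)
    (jointlyInjective_valueProj Cowedge.genValue) (fun p => p.2.toHom n c) (coendMap P Q n c)
    (fun p => totMap_coendMap P Q p n c)
  w α c l x s := LinearMap.ext fun a => (jointlyInjective_valueProj Cowedge.genValue).ext fun p =>
    (totMap_coendMap P Q p _ _ _ _ _).trans
      ((LinearMap.congr_fun (p.2.w α c l x s) a).trans (totMap_coendMap P Q p _ _ _ _ _).symm)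

/-- The coend `∫^n (P × Δ^n × G^n) ⊗ Q`. -/
noncomputable def coend : Chains P Q where
  obj := valueAlg (V := Cowedge P Q) Cowedge.genValue
  cowedge := coendCowedge P Q
  existsUnique_desc B v := by
    -- The cowedge `v` is itself an index of the product, and projection to its factor is the
    -- induced morphism.
    refine ⟨valueHom Cowedge.genValue ⟨B, v⟩, fun n c l y => LinearMap.ext fun a =>
      (totMap_coendMap P Q ⟨B, v⟩ n c l y a).symm, fun f hf => valueAlg_hom_ext _ _ _ ?_⟩
    intro j i
    by_cases hi : i = j.e + j.l
    · subst hi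
      have h := LinearMap.congr_fun (hf j.n j.c j.l j.y)
        (DirectSum.lof k ℤ (fun i => Q.under.X.X i) j.e j.a)
      refine Eq.trans ?_ (h.symm.trans (totMap_valueProj_gen ⟨B, v⟩ j).symm)
      exact congrArg (totMap f.hom) (coendMap_lof P Q j).symm
    · rw [toTot_gen_of_ne j hi]
      exact (map_zero (totMap f.hom)).trans (map_zero (totMap _)).symm

/-! ### Functoriality of the coend in the bundle. -/

variable {P Q}

/-- The restriction of a cowedge along a morphism of bundles. -/
noncomputable def Cowedge.precomp {P' : PBun G X} {B : EInftyAlg k} (f : P ⟶ P')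
    (v : Cowedge P' Q B) : Cowedge P Q B where
  toHom n c := (v.toHom n c).precomp (f.hom ▷ Δ[n])
  w {m n} α c l p s := by
    have h := v.w α c l (f.hom.app _ p) s
    -- Equivariance moves the right action by the last edge from `P'` back to `P`.
    rw [← f.map_ract] at h
    exact h

lemma Chains.existsUnique_isInduced {P' : PBun G X} (H : Chains P Q) (H' : Chains P' Q)
    (f : P ⟶ P') : ∃! F : H.obj ⟶ H'.obj, H.IsInduced H' f F := by
  obtain ⟨F, hF, hu⟩ := H.existsUnique_desc H'.obj (H'.cowedge.precomp f)
  exact ⟨F, fun n c l p s => (hF n c l (p, s)).symm,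
    fun F' h' => hu F' fun n c l y => (h' n c l y.1 y.2).symm⟩

lemma Chains.IsInduced.id (H : Chains P Q) : H.IsInduced H (𝟙 P) (𝟙 H.obj) := by
  intro n c l p s
  change totMap (𝟙 H.obj.X) ∘ₗ _ = _
  rw [totMap_id]
  rfl

lemma Chains.IsInduced.comp {P' P'' : PBun G X} {H : Chains P Q} {H' : Chains P' Q}
    {H'' : Chains P'' Q} {f : P ⟶ P'} {g : P' ⟶ P''} {F : H.obj ⟶ H'.obj}
    {F' : H'.obj ⟶ H''.obj} (hF : H.IsInduced H' f F) (hF' : H'.IsInduced H'' g F') :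
    H.IsInduced H'' (f ≫ g) (F ≫ F') := by
  intro n c l p s
  change totMap (F.hom ≫ F'.hom) ∘ₗ _ = _
  rw [totMap_comp, LinearMap.comp_assoc, hF n c l p s]
  exact hF' n c l _ s

/-- The morphism induced on coends by a morphism of bundles. -/
noncomputable def Chains.map {P' : PBun G X} (H : Chains P Q) (H' : Chains P' Q) (f : P ⟶ P') :
    H.obj ⟶ H'.obj :=
  (H.existsUnique_isInduced H' f).choose

lemma Chains.isInduced_map {P' : PBun G X} (H : Chains P Q) (H' : Chains P' Q) (f : P ⟶ P') :
    H.IsInduced H' f (H.map H' f) :=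
  (H.existsUnique_isInduced H' f).choose_spec.1

lemma Chains.IsInduced.eq_map {P' : PBun G X} {H : Chains P Q} {H' : Chains P' Q} {f : P ⟶ P'}
    {F : H.obj ⟶ H'.obj} (h : H.IsInduced H' f F) : F = H.map H' f :=
  (H.existsUnique_isInduced H' f).choose_spec.2 F h

lemma Chains.map_id (H : Chains P Q) : H.map H (𝟙 P) = 𝟙 H.obj :=
  (Chains.IsInduced.id H).eq_map.symm

lemma Chains.map_comp {P' P'' : PBun G X} (H : Chains P Q) (H' : Chains P' Q)
    (H'' : Chains P'' Q) (f : P ⟶ P') (g : P' ⟶ P'') :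
    H.map H'' (f ≫ g) = H.map H' f ≫ H'.map H'' g :=
  ((H.isInduced_map H' f).comp (H'.isInduced_map H'' g)).eq_map.symm

/-- The functor given by a choice of coends. -/
noncomputable def Chains.functor (H : ∀ P : PBun G X, Chains P Q) : PBun G X ⥤ EInftyAlg k where
  obj P := (H P).obj
  map f := (H _).map (H _) f
  map_id P := (H P).map_id
  map_comp f g := (H _).map_comp (H _) (H _) f g

/-- The isomorphism induced on coends by an isomorphism of bundles. -/
noncomputable def Chains.mapIso {P' : PBun G X} (H : Chains P Q) (H' : Chains P' Q) (f : P ≅ P') :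
    H.obj ≅ H'.obj where
  hom := H.map H' f.hom
  inv := H'.map H f.inv
  hom_inv_id := by rw [← Chains.map_comp, f.hom_inv_id, Chains.map_id]
  inv_hom_id := by rw [← Chains.map_comp, f.inv_hom_id, Chains.map_id]

/-- The action of the bundle automorphisms on the coend. -/
noncomputable def Chains.autAction (H : Chains P Q) : Aut P →* Aut H.obj where
  toFun g := H.mapIso H g
  map_one' := Iso.ext H.map_id
  -- In `Aut` the product `g * h` is `h` followed by `g`, on both sides, so covariance yields a
  -- homomorphism.
  map_mul' g h := Iso.ext (H.map_comp H H h.hom g.hom)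

end Coend

end EqHH

theorem proposition2p8 {k : Type u} [Field k] {G : Type u} [Group G] (X : SSet.{u})
    {A Q : EqHH.EquivEInftyAlg G k} (q : Q ⟶ A) (hq : EqHH.IsCofReplacement q) :
    (∀ P : EqHH.PBun G X, Nonempty (EqHH.Chains P Q)) ∧
    (∀ H : ∀ P : EqHH.PBun G X, EqHH.Chains P Q,
      ∃! F : EqHH.PBun G X ⥤ EqHH.EInftyAlg k, ∃ hF : ∀ P, F.obj P = (H P).obj,
        ∀ (P P' : EqHH.PBun G X) (f : P ⟶ P'), (H P).IsInduced (H P') f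
          (eqToHom (hF P).symm ≫ F.map f ≫ eqToHom (hF P'))) ∧
    (∀ (φ₀ φ₁ : X ⟶ EqHH.BG G) (H₀ : EqHH.HochschildChains φ₀ Q)
      (H₁ : EqHH.HochschildChains φ₁ Q) (f : EqHH.bundleOf φ₀ ≅ EqHH.bundleOf φ₁),
      ∃ F : H₀.obj ≅ H₁.obj, H₀.IsInduced H₁ f.hom F.hom) ∧
    (∀ (φ : X ⟶ EqHH.BG G) (H : EqHH.HochschildChains φ Q),
      ∃ ρ : Aut (EqHH.bundleOf φ) →* Aut H.obj, ∀ g, H.IsInduced H g.hom (ρ g).hom) := by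
  refine ⟨fun P => ⟨EqHH.coend P Q⟩, fun H => ?_,
    fun φ₀ φ₁ H₀ H₁ f => ⟨H₀.mapIso H₁ f, H₀.isInduced_map H₁ f.hom⟩,
    fun φ H => ⟨H.autAction, fun g => H.isInduced_map H g.hom⟩⟩
  refine ⟨EqHH.Chains.functor H, ⟨fun _ => rfl, fun P P' f => ?_⟩, ?_⟩
  · change (H P).IsInduced (H P') f (𝟙 _ ≫ (H P).map (H P') f ≫ 𝟙 _)
    rw [Category.id_comp, Category.comp_id]
    exact (H P).isInduced_map (H P') f
  · rintro F ⟨hF, h⟩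
    -- Conjugated by the identifications `hF`, the map `F.map f` is induced by `f`, hence equal to
    -- the unique induced morphism.
    refine CategoryTheory.Functor.ext hF fun P P' f => ?_
    change F.map f = eqToHom (hF P) ≫ (H P).map (H P') f ≫ eqToHom (hF P').symm
    rw [← (h P P' f).eq_map]
    simp
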